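/- Proposition 6.5 (Shioda quintic curves). Work over $\mathbb{C}$. For $t\in\mathbb{P}^1=\mathbb{C}\cup\{\infty\}$ let $X_t\subset\mathbb{P}^3$ be the quintic surface $F_t=0$, where $$F_t=x_0x_1^4+x_1x_2^4+x_2x_0^4+x_3^5+t\,x_3x_1^4\quad(t\in\mathbb{C}),\qquad F_\infty=x_3x_1^4 .$$ Let $Z_{1,t}=X_t\cap\{x_3=0\}$ and $Z_{2,t}=X_t\cap\{x_0=0\}$ (scheme-theoretic intersections in $\mathbb{P}^3$; for $t\neq\infty$ they are plane curves, while $Z_{1,\infty}$ is the plane $x_3=0$), and put $P=(0:1:0:0)$, $Q=(0:0:1:0)$. For a closed subscheme $Z\subset\mathbb{P}^3$, let $CH_0(Z)$ be the group of zero-cycles on $Z$ modulo the subgroup generated by the divisors of nonzero rational functions on integral closed curves contained in $Z$. Then: (a) $Z_{1,t}$ is smooth over $\mathbb{C}$ for all $t$; $Z_{2,t}$ is smooth over $\mathbb{C}$ for all $t\neq 0,\infty$; and $Z_{2,0}$ is a rational curve (integral, with function field isomorphic over $\mathbb{C}$ to $\mathbb{C}(s)$) which has a point of multiplicity $4$ at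 $P$. (b) $P,Q\in Z_{1,t}\cap Z_{2,t}$ for all $t$. (c) $4P=4Q$ in $CH_0(Z_{2,t})$ for all $t$. (d) $13P=13Q$ in $CH_0(Z_{1,t})$ for all $t$. -/

import Mathlib

/-!
Closed subschemes of complex projective three-space are given by homogeneous ideals of the
homogeneous coordinate ring `ℂ[x₀, x₁, x₂, x₃]`; points are elements of Mathlib's projectivization.
-/

open MvPolynomial
open scoped LinearAlgebra.Projectivization

noncomputable section

namespace ShiodaQuintic

/-- The homogeneous coordinate ring `ℂ[x₀, x₁, x₂, x₃]` of `ℙ³`. -/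
abbrev S : Type := MvPolynomial (Fin 4) ℂ

/-- The (closed) points of `ℙ³` over `ℂ`. -/
abbrev P3 : Type := ℙ ℂ (Fin 4 → ℂ)

/-- The homogeneous prime ideal of a point `p = [v]` of `ℙ³`: the polynomials `f` such that
`f(v T)` is the zero polynomial in `T`, that is, which vanish on the line `ℂ v`. -/
def pointIdeal (p : P3) : Ideal S :=
  RingHom.ker (aeval (fun i => Polynomial.C (p.rep i) * Polynomial.X) : S →ₐ[ℂ] Polynomial ℂ)

/-- Each `pointIdeal p` is prime. -/
instance pointIdeal_isPrime (p : P3) : (pointIdeal p).IsPrime :=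
  RingHom.ker_isPrime _

/-- `pointIdeal p` is the ideal of all polynomials vanishing on the line that `p` is. -/
theorem mem_pointIdeal_iff (p : P3) (f : S) :
    f ∈ pointIdeal p ↔ ∀ c : ℂ, eval (c • p.rep) f = 0 := by
  have key : ∀ c : ℂ, Polynomial.eval c
      (aeval (fun i => Polynomial.C (p.rep i) * Polynomial.X) f : Polynomial ℂ) =
      eval (c • p.rep) f := by
    intro c
    induction f using MvPolynomial.induction_on with
    | C a => simp
    | add f g hf hg => rw [map_add, map_add, Polynomial.eval_add, hf, hg]
    | mul_X f i hf =>
      rw [map_mul, map_mul, Polynomial.eval_mul, hf, aeval_X, eval_X, Polynomial.eval_mul,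
        Polynomial.eval_C, Polynomial.eval_X, Pi.smul_apply, smul_eq_mul, mul_comm c]
  constructor
  · intro hf c
    rw [← key c, (RingHom.mem_ker).1 hf, Polynomial.eval_zero]
  · intro h
    refine (RingHom.mem_ker).2 (Polynomial.funext fun c => ?_)
    rw [Polynomial.eval_zero]
    exact (key c).trans (h c)

/-- The point `p` lies on the closed subscheme `V(I)` of `ℙ³`. -/
def MemV (I : Ideal S) (p : P3) : Prop := I ≤ pointIdeal p

/-- The coordinate ring of the affine chart `{xᵢ ≠ 0}` of the closed subscheme `V(I)`, for `I`
homogeneous: one sets `xᵢ = 1`. -/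
abbrev ChartRing (I : Ideal S) (i : Fin 4) : Type := S ⧸ (I ⊔ Ideal.span {X i - 1})

/-- The closed subscheme `V(I)` of `ℙ³` is smooth over `ℂ`: each of its four standard affine
charts is. -/
def IsSmoothV (I : Ideal S) : Prop := ∀ i : Fin 4, Algebra.Smooth ℂ (ChartRing I i)

/-- `C` is the homogeneous prime ideal of an integral closed curve in `ℙ³` (so that its affine
cone has dimension two). -/
structure IsCurve (C : Ideal S) : Prop where
  isPrime : C.IsPrime
  isHomogeneous : ∀ f ∈ C, ∀ d : ℕ, homogeneousComponent d f ∈ C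
  dim : ringKrullDim (S ⧸ C) = 2

/-- The closed subscheme `V(I)` is a rational curve: an integral curve whose function field (the
fraction field of a nonempty affine chart) is isomorphic over `ℂ` to `ℂ(s)`. -/
def IsRationalCurve (I : Ideal S) : Prop :=
  IsCurve I ∧ ∃ i : Fin 4, X i ∉ I ∧ Nonempty (FractionRing (ChartRing I i) ≃ₐ[ℂ] RatFunc ℂ)

/-- The localization of the homogeneous coordinate ring of `ℙ³` at the prime of the point `p`. -/
abbrev ConeLocalRing (p : P3) : Type := Localization.AtPrime (pointIdeal p)

/-- The multiplicity at `p` of the curve cut out on the smooth subscheme `V(H)` (a plane) by the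
form `F` is `m`: the order of vanishing of `F` at `p`, i.e. `F` lies in the `m`-th but not in the
`(m+1)`-st power of the maximal ideal of the local ring modulo `H`. -/
def HasMultiplicity (H : Ideal S) (F : S) (p : P3) (m : ℕ) : Prop :=
  let R := ConeLocalRing p
  let H' : Ideal R := H.map (algebraMap S R)
  algebraMap S R F ∈ (IsLocalRing.maximalIdeal R) ^ m ⊔ H' ∧
    algebraMap S R F ∉ (IsLocalRing.maximalIdeal R) ^ (m + 1) ⊔ H'

/-- The multiplicity of `S ⧸ J` at the prime of the point `p`: the length of its localization.
For `J = C + (G)`, with `C` the ideal of a curve and `G` a form not in `C`, this is the (finite)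
intersection multiplicity at `p` of the curve with `{G = 0}`, i.e. the order of `G` at `p`
on the curve; it is `0` when `p` is not on both. -/
def multAt (p : P3) (J : Ideal S) : ℕ∞ :=
  Module.length (ConeLocalRing p)
    (ConeLocalRing p ⧸ J.map (algebraMap S (ConeLocalRing p)))

/-- The order at `p` of the rational function `G / N` on the curve with ideal `C`. -/
def ordAt (C : Ideal S) (G N : S) (p : P3) : ℤ :=
  ((multAt p (C ⊔ Ideal.span {G})).toNat : ℤ) - ((multAt p (C ⊔ Ideal.span {N})).toNat : ℤ)

/-- Zero-cycles on `V(I)`: formal integral combinations of its points. -/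
abbrev ZeroCycle (I : Ideal S) : Type := {p : P3 // MemV I p} →₀ ℤ

/-- The zero-cycle `D` is the divisor of a nonzero rational function on some integral closed
curve contained in `V(I)`. A nonzero rational function on the curve `C` is a quotient `G / N` of
two forms of equal degree, neither vanishing identically on the curve. -/
def IsPrincipal (I : Ideal S) (D : ZeroCycle I) : Prop :=
  ∃ C : Ideal S, IsCurve C ∧ I ≤ C ∧ ∃ (d : ℕ) (G N : S),
    G.IsHomogeneous d ∧ N.IsHomogeneous d ∧ G ∉ C ∧ N ∉ C ∧ ∀ p, D p = ordAt C G N p.1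

/-- The Chow group `CH₀` of the closed subscheme `V(I)`: zero-cycles modulo the subgroup generated
by divisors of rational functions on integral curves in `V(I)`. -/
abbrev CH0 (I : Ideal S) : Type :=
  ZeroCycle I ⧸ AddSubgroup.closure {D : ZeroCycle I | IsPrincipal I D}

/-- The class in `CH₀(V(I))` of a point of `V(I)`. -/
def CH0.ofPoint (I : Ideal S) (p : P3) (hp : MemV I p) : CH0 I :=
  QuotientAddGroup.mk (Finsupp.single ⟨p, hp⟩ 1)

/-- The equation `F_t` of the quintic surface `X_t`, for `t ∈ ℙ¹ = ℂ ∪ {∞}`; the member at `∞` of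
the pencil is `x₃ x₁⁴ = 0`. -/
def F : OnePoint ℂ → S
  | none => X 3 * X 1 ^ 4
  | some t => X 0 * X 1 ^ 4 + X 1 * X 2 ^ 4 + X 2 * X 0 ^ 4 + X 3 ^ 5 + C t * X 3 * X 1 ^ 4

/-- The ideal of `Z_{1,t} = X_t ∩ {x₃ = 0}`. -/
def Z₁ (t : OnePoint ℂ) : Ideal S := Ideal.span {F t, X 3}

/-- The ideal of `Z_{2,t} = X_t ∩ {x₀ = 0}`. -/
def Z₂ (t : OnePoint ℂ) : Ideal S := Ideal.span {F t, X 0}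

/-- The point `(0 : 1 : 0 : 0)`. -/
def P : P3 := Projectivization.mk ℂ ![0, 1, 0, 0] (fun h => by simpa using congrFun h 1)

/-- The point `(0 : 0 : 1 : 0)`. -/
def Q : P3 := Projectivization.mk ℂ ![0, 0, 1, 0] (fun h => by simpa using congrFun h 2)

end ShiodaQuintic

end

open MvPolynomial
open scoped LinearAlgebra.Projectivization

noncomputable section

namespace ShiodaQuintic

/-! Write A, P, Q, E for the coordinate points with x₀, x₁, x₂, x₃ nonzero. For finite t both curves
are integral plane curves whose equations restrict to monomials on coordinate lines, so divisors of
coordinates can be read off. On Z₁ the divisors of x₀, x₁, x₂ are 4P + Q, 4Q + A, 4A + P; equating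
their classes gives A = 4P - 3Q and then 13P = 13Q. On Z₂ the divisors of x₃ and x₁ are 4P + Q and
5Q, so 4P = 4Q; this also holds at t = 0, since orders are lengths and need no smoothness. For t = ∞
both schemes contain the line PQ, on which x₂/x₁ already gives P = Q. The orders come from
`multAt_span`, the relations from `mk_eq_zero_of_coord` and `ofPoint_relation`. Integrality is
Eisenstein's criterion at x₁ (`prime_eisenstein`), transported by `isPrime_of_retract`; dimension
two is `isCurve_span`. Smoothness is the Jacobian criterion on each chart (`smooth_chart`), with
explicit polynomial certificates. The curve Z₂ at t = 0 is x₁x₂⁴ + x₃⁵ = 0: a graph over the x₃-line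
where x₂ = 1, and of order 4 at P. -/

/-! ### Retracts of polynomial rings, the Jacobian criterion, and a length computation. -/

/-- If every variable is congruent to its image under an endomorphism modulo `I`, so is every
polynomial. -/
theorem sub_apply_mem_of_forall_X {σ R : Type*} [CommRing R] (I : Ideal (MvPolynomial σ R))
    (e : MvPolynomial σ R →ₐ[R] MvPolynomial σ R) (h : ∀ i, X i - e (X i) ∈ I)
    (f : MvPolynomial σ R) : f - e f ∈ I := by
  have : (Ideal.Quotient.mkₐ R I) = (Ideal.Quotient.mkₐ R I).comp e :=
    MvPolynomial.algHom_ext fun i => by simpa using Ideal.Quotient.eq.2 (h i)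
  exact Ideal.Quotient.eq.1 (DFunLike.congr_fun this f)

/-- An ideal of a polynomial ring that is, up to retraction, a prime of another algebra is
prime. -/
theorem isPrime_of_retract {σ R B : Type*} [CommRing R] [CommRing B] [Algebra R B]
    (I : Ideal (MvPolynomial σ R)) (J : Ideal B) [hJ : J.IsPrime]
    (φ : MvPolynomial σ R →ₐ[R] B) (ψ : B →ₐ[R] MvPolynomial σ R)
    (hφ : I ≤ J.comap φ) (hψ : J ≤ I.comap ψ) (h : ∀ i, X i - ψ (φ (X i)) ∈ I) :
    I.IsPrime := by
  have : I = J.comap φ := le_antisymm hφ fun f hf => by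
    have h1 := sub_apply_mem_of_forall_X I (ψ.comp φ) h f
    have h2 : ψ (φ f) ∈ I := hψ hf
    simpa using I.add_mem h1 h2
  rw [this]
  exact hJ.comap φ

/-- The quotient by an ideal generated by equations that solve for the variables in terms of the
elements of another algebra. -/
def quotientEquivOfRetract {σ R B : Type*} [CommRing R] [CommRing B] [Algebra R B]
    (I : Ideal (MvPolynomial σ R)) (φ : MvPolynomial σ R →ₐ[R] B)
    (ψ : B →ₐ[R] MvPolynomial σ R) (hφ : ∀ f ∈ I, φ f = 0) (hφψ : φ.comp ψ = AlgHom.id R B)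
    (h : ∀ i, X i - ψ (φ (X i)) ∈ I) : (MvPolynomial σ R ⧸ I) ≃ₐ[R] B :=
  AlgEquiv.ofAlgHom (Ideal.Quotient.liftₐ I φ hφ) ((Ideal.Quotient.mkₐ R I).comp ψ)
    (by
      rw [← AlgHom.comp_assoc]
      exact hφψ)
    (by
      refine Ideal.Quotient.algHom_ext _ (MvPolynomial.algHom_ext fun i => ?_)
      exact (Ideal.Quotient.eq.2 (h i)).symm)

/-- First-order Taylor expansion modulo the square of an ideal. -/
theorem aeval_sub_sub_mem_sq {σ R : Type*} [Fintype σ] [CommRing R]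
    (I : Ideal (MvPolynomial σ R)) (u : σ → MvPolynomial σ R) (hu : ∀ k, u k ∈ I)
    (f : MvPolynomial σ R) :
    aeval (fun k => X k + u k) f - (f + ∑ k, u k * pderiv k f) ∈ I ^ 2 := by
  induction f using MvPolynomial.induction_on with
  | C a => simp
  | add f g hf hg =>
    have := (I ^ 2).add_mem hf hg
    simp only [map_add, mul_add, Finset.sum_add_distrib]
    convert this using 1
    ring
  | mul_X f i hf =>
    classical
    have h1 : ∑ k, u k * pderiv k (f * X i) = (∑ k, u k * pderiv k f) * X i + u i * f := by
      simp only [pderiv_mul, mul_add, Finset.sum_add_distrib, Finset.sum_mul, pderiv_X]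
      congr 1
      · exact Finset.sum_congr rfl fun k _ => by ring
      · rw [Finset.sum_eq_single i]
        · simp
        · intro b _ hb
          simp [hb.symm]
        · simp
    have h2 : ∑ k, u k * pderiv k f ∈ I := I.sum_mem fun k _ => I.mul_mem_right _ (hu k)
    have h3 : (∑ k, u k * pderiv k f) * u i ∈ I ^ 2 := by
      rw [sq]
      exact Ideal.mul_mem_mul h2 (hu i)
    rw [h1, map_mul, aeval_X]
    have h4 := (I ^ 2).add_mem ((I ^ 2).mul_mem_right (X i + u i) hf) h3
    convert h4 using 1
    ring

/-- The Jacobian criterion: if the Jacobian matrix of generators of `I` has a right inverse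
modulo `I`, then the quotient by `I` is smooth. -/
theorem smooth_of_jacobian {σ ι : Type} {R : Type} [Fintype σ] [Fintype ι] [DecidableEq ι]
    [CommRing R] (g : ι → MvPolynomial σ R) (I : Ideal (MvPolynomial σ R))
    (hI : I = Ideal.span (Set.range g)) (v : ι → σ → MvPolynomial σ R)
    (hv : ∀ i j, ∑ k, v i k * pderiv k (g j) - (if i = j then 1 else 0) ∈ I) :
    Algebra.Smooth R (MvPolynomial σ R ⧸ I) := by
  have hg : ∀ i, g i ∈ I := fun i => hI ▸ Ideal.subset_span ⟨i, rfl⟩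
  have hfp : Algebra.FinitePresentation R (MvPolynomial σ R ⧸ I) :=
    Algebra.FinitePresentation.quotient (hI ▸ Submodule.fg_span (Set.finite_range g))
  -- A Newton step: by Taylor expansion and `hv`, moving X by u sends each `g j` to `g j - g j = 0`
  -- modulo I². The substitution thus induces a section of the projection from the quotient by I² to
  -- the quotient by I, which is formal smoothness.
  set u : σ → MvPolynomial σ R := fun k => -∑ i, g i * v i k with hu
  have huI : ∀ k, u k ∈ I := fun k =>
    I.neg_mem (I.sum_mem fun i _ => I.mul_mem_right _ (hg i))
  let s : MvPolynomial σ R →ₐ[R] MvPolynomial σ R := aeval fun k => X k + u k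
  have hs : ∀ f ∈ I, s f ∈ I ^ 2 := by
    suffices I ≤ (I ^ 2).comap s from this
    conv_lhs => rw [hI]
    rw [Ideal.span_le]
    rintro _ ⟨j, rfl⟩
    have h1 : s (g j) - (g j + ∑ k, u k * pderiv k (g j)) ∈ I ^ 2 :=
      aeval_sub_sub_mem_sq I u huI (g j)
    have h2 : ∑ k, u k * pderiv k (g j) = -∑ i, g i * ∑ k, v i k * pderiv k (g j) := by
      simp only [hu, neg_mul, Finset.sum_mul, Finset.mul_sum, Finset.sum_neg_distrib]
      rw [Finset.sum_comm]
      simp only [mul_assoc]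
    have h3 : ∑ i, g i * (∑ k, v i k * pderiv k (g j) - if i = j then 1 else 0) ∈ I ^ 2 :=
      (I ^ 2).sum_mem fun i _ => by
        rw [sq]
        exact Ideal.mul_mem_mul (hg i) (hv i j)
    simp only [mul_sub, Finset.sum_sub_distrib, mul_ite, mul_one, mul_zero,
      Finset.sum_ite_eq', Finset.mem_univ, if_true] at h3
    have h4 := (I ^ 2).sub_mem h1 h3
    rw [h2] at h4
    change s (g j) ∈ I ^ 2
    convert h4 using 1
    ring
  let f : MvPolynomial σ R →ₐ[R] MvPolynomial σ R ⧸ I := Ideal.Quotient.mkₐ R I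
  have hker : RingHom.ker f.toRingHom = I := Ideal.Quotient.mkₐ_ker R I
  have hfs : Algebra.FormallySmooth R (MvPolynomial σ R ⧸ I) := by
    refine Algebra.FormallySmooth.of_split f
      (Ideal.Quotient.liftₐ I ((Ideal.Quotient.mkₐ R (RingHom.ker f.toRingHom ^ 2)).comp s) ?_) ?_
    · intro a ha
      rw [AlgHom.comp_apply, Ideal.Quotient.mkₐ_eq_mk, Ideal.Quotient.eq_zero_iff_mem, hker]
      exact hs a ha
    · refine Ideal.Quotient.algHom_ext _ (MvPolynomial.algHom_ext fun i => ?_)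
      have : f (s (X i)) = f (X i) := by
        refine Ideal.Quotient.eq.2 ?_
        simpa [s] using huI i
      exact this
  exact ⟨hfs, hfp⟩

/-- In a local ring whose maximal ideal is generated by `z` modulo `J`, the quotient by `J` and
`z ^ n` has length `n` as long as the powers of `z` do not stabilize. -/
theorem length_quotient_sup_span_pow {R : Type*} [CommRing R] [IsLocalRing R] (J : Ideal R)
    (z : R) (hm : J ⊔ Ideal.span {z} = IsLocalRing.maximalIdeal R)
    (hz : ∀ n, z ^ n ∉ J ⊔ Ideal.span {z ^ (n + 1)}) (n : ℕ) :
    Module.length R (R ⧸ (J ⊔ Ideal.span {z ^ n})) = n := by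
  induction n with
  | zero =>
    have : J ⊔ Ideal.span {z ^ 0} = ⊤ := by simp
    rw [this]
    simp
  | succ n ih =>
    have hle : J ⊔ Ideal.span {z ^ (n + 1)} ≤ J ⊔ Ideal.span {z ^ n} :=
      sup_le_sup_left (Ideal.span_singleton_le_span_singleton.2 (pow_dvd_pow z n.le_succ)) J
    have hmul : IsLocalRing.maximalIdeal R ≤
        Submodule.comap (LinearMap.mulLeft R (z ^ n)) (J ⊔ Ideal.span {z ^ (n + 1)}) := by
      rw [← hm, sup_le_iff, Ideal.span_le, Set.singleton_subset_iff]
      constructor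
      · intro r hr
        exact Ideal.mul_mem_left _ _ (Ideal.mem_sup_left hr)
      · change z ^ n * z ∈ J ⊔ Ideal.span {z ^ (n + 1)}
        rw [← pow_succ]
        exact Ideal.mem_sup_right (Ideal.mem_span_singleton_self _)
    -- Multiplication by zⁿ embeds the residue field as the kernel of the projection from level n +
    -- 1 to level n, so each level adds one to the length. The residue field is simple, so
    -- injectivity only needs zⁿ to be nonzero at level n + 1.
    let f := Submodule.mapQ (IsLocalRing.maximalIdeal R) (J ⊔ Ideal.span {z ^ (n + 1)})
      (LinearMap.mulLeft R (z ^ n)) hmul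
    let g := Submodule.factor hle
    have hsimple : IsSimpleModule R (R ⧸ IsLocalRing.maximalIdeal R) :=
      isSimpleModule_iff_isCoatom.2 (IsLocalRing.maximalIdeal.isMaximal R).out
    have hf : Function.Injective f := by
      refine (LinearMap.injective_or_eq_zero f).resolve_right fun h0 => hz n ?_
      have h1 : f (Submodule.Quotient.mk 1) = 0 := by rw [h0]; rfl
      rw [Submodule.mapQ_apply, Submodule.Quotient.mk_eq_zero] at h1
      simpa using h1
    have hex : Function.Exact f g := by
      intro y
      obtain ⟨y, rfl⟩ := Submodule.Quotient.mk_surjective _ y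
      constructor
      · intro hy
        have hy' : y ∈ J ⊔ Ideal.span {z ^ n} := (Submodule.Quotient.mk_eq_zero _).1 hy
        obtain ⟨a, ha, b, hb, rfl⟩ := Submodule.mem_sup.1 hy'
        obtain ⟨c, rfl⟩ := Ideal.mem_span_singleton.1 hb
        refine ⟨Submodule.Quotient.mk c, (Submodule.Quotient.eq _).2 ?_⟩
        change z ^ n * c - (a + z ^ n * c) ∈ J ⊔ Ideal.span {z ^ (n + 1)}
        rw [show z ^ n * c - (a + z ^ n * c) = -a by ring]
        exact Ideal.neg_mem_iff _ |>.2 (Ideal.mem_sup_left ha)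
      · rintro ⟨x, hx⟩
        obtain ⟨x, rfl⟩ := Submodule.Quotient.mk_surjective _ x
        rw [← hx]
        refine (Submodule.Quotient.mk_eq_zero _).2 ?_
        exact Ideal.mul_mem_right _ _ (Ideal.mem_sup_right (Ideal.mem_span_singleton_self _))
    rw [Module.length_eq_add_of_exact f g hf (Submodule.factor_surjective hle) hex, ih,
      Module.length_eq_one]
    push_cast
    ring

/-! ### Coordinate points and their ideals. -/

theorem mem_pointIdeal_mk (v : Fin 4 → ℂ) (hv : v ≠ 0) (f : S) :
    f ∈ pointIdeal (Projectivization.mk ℂ v hv) ↔ ∀ c : ℂ, eval (c • v) f = 0 := by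
  obtain ⟨a, ha⟩ := Projectivization.exists_smul_eq_mk_rep ℂ v hv
  rw [mem_pointIdeal_iff, ← ha]
  constructor
  · intro h c
    have := h (c * (a⁻¹ : ℂˣ))
    rwa [Units.smul_def, smul_smul, mul_assoc, Units.inv_mul, mul_one] at this
  · intro h c
    rw [Units.smul_def, smul_smul]
    exact h _

theorem X_mem_pointIdeal_iff (p : P3) (i : Fin 4) : X i ∈ pointIdeal p ↔ p.rep i = 0 := by
  rw [mem_pointIdeal_iff]
  constructor
  · intro h
    simpa using h 1
  · intro h c
    simp [h]

/-- The coordinate points of `ℙ³`. -/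
def coordPoint (l : Fin 4) : P3 :=
  Projectivization.mk ℂ (Pi.single l 1) (by simp)

theorem P_eq_coordPoint : P = coordPoint 1 := by
  unfold P coordPoint
  congr 1
  ext i
  fin_cases i <;> rfl

theorem Q_eq_coordPoint : Q = coordPoint 2 := by
  unfold Q coordPoint
  congr 1
  ext i
  fin_cases i <;> rfl

theorem mem_pointIdeal_coordPoint (l : Fin 4) (f : S) :
    f ∈ pointIdeal (coordPoint l) ↔ ∀ c : ℂ, eval (Pi.single l c) f = 0 := by
  simp [coordPoint, mem_pointIdeal_mk, ← Pi.single_smul]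

theorem X_mem_pointIdeal_coordPoint (l i : Fin 4) :
    X i ∈ pointIdeal (coordPoint l) ↔ i ≠ l := by
  rw [mem_pointIdeal_coordPoint]
  constructor
  · rintro h rfl
    simpa using h 1
  · intro h c
    simp [h]

theorem coordPoint_injective : Function.Injective coordPoint := by
  intro l m h
  by_contra hne
  have := (X_mem_pointIdeal_coordPoint m l).2 hne
  rw [← h, X_mem_pointIdeal_coordPoint] at this
  exact this rfl

theorem eq_coordPoint (p : P3) (l : Fin 4) (h : ∀ i, i ≠ l → X i ∈ pointIdeal p) :
    p = coordPoint l := by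
  rw [← p.mk_rep]
  refine (Projectivization.mk_eq_mk_iff' ℂ _ _ _ _).2 ⟨p.rep l, ?_⟩
  ext i
  by_cases hi : i = l
  · subst hi
    simp
  · simp [hi, (X_mem_pointIdeal_iff p i).1 (h i hi)]

/-- Setting every variable except x_l to zero changes f only by an element of I, and turns a member
of the point ideal into a polynomial with all values zero, hence into 0. -/
theorem pointIdeal_coordPoint_le (l : Fin 4) (I : Ideal S) (h : ∀ i, i ≠ l → X i ∈ I) :
    pointIdeal (coordPoint l) ≤ I := by
  intro f hf
  let e : S →ₐ[ℂ] S := aeval (Pi.single l (X l))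
  have h1 := sub_apply_mem_of_forall_X I e (fun i => by
    by_cases hi : i = l
    · subst hi
      simp [e]
    · simpa [e, hi] using h i hi) f
  have h2 : e f = 0 := by
    refine MvPolynomial.funext fun x => ?_
    have h3 : ((aeval x : S →ₐ[ℂ] ℂ).comp e) = aeval (Pi.single l (x l)) :=
      MvPolynomial.algHom_ext fun i => by
        by_cases hi : i = l
        · subst hi
          simp [e]
        · simp [e, hi]
    have h4 := DFunLike.congr_fun h3 f
    rw [mem_pointIdeal_coordPoint] at hf
    simpa [aeval_eq_eval, hf] using h4
  simpa [h2] using h1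

/-! ### Intersection multiplicities at coordinate points. -/

/-- The germ at the generic point of the line over `coordPoint l` of the restriction of forms to
the plane where all coordinates but `x_l` and `x_k` vanish, expanded in powers of `x_k`. -/
def expand (l k : Fin 4) : S →ₐ[ℂ] PowerSeries (RatFunc ℂ) :=
  aeval fun i => if i = l then PowerSeries.C RatFunc.X else if i = k then PowerSeries.X else 0

/-- The constant term of the series is the restriction of f to the x_l-axis, a polynomial in one
variable which is nonzero exactly when f is outside the point ideal. Coefficients in ℂ(s) make it
invertible. -/
theorem isUnit_expand {l k : Fin 4} {f : S} (hf : f ∉ pointIdeal (coordPoint l)) :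
    IsUnit (expand l k f) := by
  rw [PowerSeries.isUnit_iff_constantCoeff, isUnit_iff_ne_zero]
  let c : S →ₐ[ℂ] Polynomial ℂ := aeval (Pi.single l Polynomial.X)
  have h1 : ((PowerSeries.constantCoeff (R := RatFunc ℂ)).comp (expand l k : S →+* _)) =
      (algebraMap (Polynomial ℂ) (RatFunc ℂ)).comp (c : S →+* _) := by
    refine MvPolynomial.ringHom_ext (fun a => ?_) (fun i => ?_)
    · simp [expand, c]
      rw [PowerSeries.algebraMap_apply, PowerSeries.constantCoeff_C, RatFunc.algebraMap_eq_C]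
    · by_cases hi : i = l
      · subst hi
        simp [expand, c]
      · by_cases hk : i = k
        · subst hk
          simp [expand, c, hi]
        · simp [expand, c, hi, hk]
  have h2 := DFunLike.congr_fun h1 f
  simp only [RingHom.comp_apply, RingHom.coe_coe] at h2
  rw [h2]
  refine (map_ne_zero_iff _ (IsFractionRing.injective (Polynomial ℂ) (RatFunc ℂ))).2 fun h0 => ?_
  apply hf
  rw [mem_pointIdeal_coordPoint]
  intro a
  have h3 : (Polynomial.aeval a).comp c = aeval (Pi.single l a) :=
    MvPolynomial.algHom_ext fun i => by
      by_cases hi : i = l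
      · subst hi
        simp [c]
      · simp [c, hi]
  have h4 := DFunLike.congr_fun h3 f
  simpa [aeval_eq_eval, h0] using h4.symm

/-- The extension of `expand` to the local ring at the coordinate point. -/
def localExpand (l k : Fin 4) : ConeLocalRing (coordPoint l) →+* PowerSeries (RatFunc ℂ) :=
  IsLocalization.lift (M := (pointIdeal (coordPoint l)).primeCompl) (g := (expand l k : S →+* _))
    fun f => isUnit_expand f.2

theorem localExpand_algebraMap (l k : Fin 4) (f : S) :
    localExpand l k (algebraMap S _ f) = expand l k f :=
  IsLocalization.lift_eq _ _

theorem mem_quadruple_of_nodup {i j k l : Fin 4} (h : [i, j, k, l].Nodup) (m : Fin 4) :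
    m = i ∨ m = j ∨ m = k ∨ m = l := by
  revert i j k l m
  decide

theorem nodup_swap {i j k l : Fin 4} (h : [i, j, k, l].Nodup) : [i, j, l, k].Nodup := by
  revert i j k l
  decide

/-- At this point x_l is a unit, and x_k generates the maximal ideal modulo x_i, x_j, so
`length_quotient_sup_span_pow` applies. Powers of x_k do not stabilize because `localExpand` kills
x_i, x_j and sends x_k to the series variable. -/
theorem multAt_coordPoint {i j k l : Fin 4} (h : [i, j, k, l].Nodup) (a b : ℕ) :
    multAt (coordPoint l) (Ideal.span {X i, X j, X k ^ a * X l ^ b}) = a := by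
  set R := ConeLocalRing (coordPoint l)
  have hcover := mem_quadruple_of_nodup h
  simp only [List.nodup_cons, List.mem_cons, List.not_mem_nil, or_false, not_or,
    not_false_eq_true, List.nodup_nil, and_true] at h
  obtain ⟨⟨hij, hik, hil⟩, ⟨hjk, hjl⟩, hkl⟩ := h
  let J : Ideal R := (Ideal.span {X i, X j}).map (algebraMap S R)
  let z : R := algebraMap S R (X k)
  have hJ : (Ideal.span {X i, X j, X k ^ a * X l ^ b}).map (algebraMap S R) =
      J ⊔ Ideal.span {z ^ a} := by
    have hu : IsUnit (algebraMap S R (X l)) :=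
      IsLocalization.map_units R (⟨X l, fun hl =>
        (X_mem_pointIdeal_coordPoint l l).1 hl rfl⟩ : (pointIdeal (coordPoint l)).primeCompl)
    rw [show ({X i, X j, X k ^ a * X l ^ b} : Set S) = {X i, X j} ∪ {X k ^ a * X l ^ b} by
      ext; simp; tauto, Ideal.span_union, Ideal.map_sup, Ideal.map_span _ {X k ^ a * X l ^ b},
      Set.image_singleton, map_mul, map_pow, map_pow,
      Ideal.span_singleton_mul_right_unit (hu.pow b)]
  have hm : J ⊔ Ideal.span {z} = IsLocalRing.maximalIdeal R := by
    rw [← Localization.AtPrime.map_eq_maximalIdeal]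
    have : pointIdeal (coordPoint l) = Ideal.span {X i, X j} ⊔ Ideal.span {X k} := by
      apply le_antisymm
      · refine pointIdeal_coordPoint_le l _ fun m hm => ?_
        rcases hcover m with rfl | rfl | rfl | rfl
        · exact Ideal.mem_sup_left (Ideal.subset_span (by simp))
        · exact Ideal.mem_sup_left (Ideal.subset_span (by simp))
        · exact Ideal.mem_sup_right (Ideal.subset_span (by simp))
        · exact absurd rfl hm
      · rw [sup_le_iff, Ideal.span_le, Ideal.span_le]
        simp only [Set.insert_subset_iff, Set.singleton_subset_iff, SetLike.mem_coe,
          X_mem_pointIdeal_coordPoint]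
        exact ⟨⟨hil, hjl⟩, hkl⟩
    have hmap := congrArg (Ideal.map (algebraMap S R)) this
    rw [Ideal.map_sup, Ideal.map_span _ {X k}, Set.image_singleton] at hmap
    exact hmap.symm
  have hz : ∀ n, z ^ n ∉ J ⊔ Ideal.span {z ^ (n + 1)} := by
    intro n hn
    have hz' : localExpand l k z = PowerSeries.X := by
      rw [localExpand_algebraMap]
      simp [expand, hkl]
    have hle : J ⊔ Ideal.span {z ^ (n + 1)} ≤
        (Ideal.span {(PowerSeries.X : PowerSeries (RatFunc ℂ)) ^ (n + 1)}).comap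
          (localExpand l k) := by
      rw [sup_le_iff]
      constructor
      · rw [Ideal.map_le_iff_le_comap, Ideal.span_le]
        rintro _ (rfl | rfl) <;>
        · rw [SetLike.mem_coe, Ideal.mem_comap, Ideal.mem_comap, localExpand_algebraMap]
          simp [expand, *]
      · rw [Ideal.span_le, Set.singleton_subset_iff, SetLike.mem_coe, Ideal.mem_comap, map_pow, hz']
        exact Ideal.mem_span_singleton_self _
    have h1 := hle hn
    rw [Ideal.mem_comap, map_pow, hz', Ideal.mem_span_singleton, PowerSeries.X_pow_dvd_iff] at h1
    simpa [PowerSeries.coeff_X_pow] using h1 n n.lt_succ_self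
  unfold multAt
  rw [hJ]
  exact length_quotient_sup_span_pow J z hm hz a

theorem multAt_eq_zero (p : P3) (J : Ideal S) (h : ¬ J ≤ pointIdeal p) : multAt p J = 0 := by
  obtain ⟨f, hf, hfp⟩ := SetLike.not_le_iff_exists.1 h
  have hu : IsUnit (algebraMap S (ConeLocalRing p) f) :=
    IsLocalization.map_units _ (⟨f, hfp⟩ : (pointIdeal p).primeCompl)
  have : J.map (algebraMap S (ConeLocalRing p)) = ⊤ :=
    Ideal.eq_top_of_isUnit_mem _ (Ideal.mem_map_of_mem _ hf) hu
  unfold multAt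
  rw [this, Module.length_eq_zero_iff]
  exact Ideal.Quotient.subsingleton_iff.2 rfl

open scoped Classical in
theorem multAt_span {i j k l : Fin 4} (h : [i, j, k, l].Nodup) (a b : ℕ) (p : P3) :
    ((multAt p (Ideal.span {X i, X j, X k ^ a * X l ^ b})).toNat : ℤ) =
      a * (if p = coordPoint l then 1 else 0) + b * (if p = coordPoint k then 1 else 0) := by
  have hlk : l ≠ k := by
    rintro rfl
    simp at h
  by_cases hl : p = coordPoint l
  · subst hl
    rw [multAt_coordPoint h]
    simp [coordPoint_injective.ne hlk]
  by_cases hk : p = coordPoint k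
  · subst hk
    rw [mul_comm, multAt_coordPoint (nodup_swap h)]
    simp [coordPoint_injective.ne hlk.symm]
  rw [multAt_eq_zero]
  · simp [hl, hk]
  · intro hle
    have hcover := mem_quadruple_of_nodup h
    have hi : X i ∈ pointIdeal p := hle (Ideal.subset_span (by simp))
    have hj : X j ∈ pointIdeal p := hle (Ideal.subset_span (by simp))
    have hm : X k ^ a * X l ^ b ∈ pointIdeal p := hle (Ideal.subset_span (by simp))
    -- Besides x_i and x_j, one of x_k, x_l vanishes at p, which forces p to be one of the two
    -- coordinate points already excluded.
    rcases (pointIdeal_isPrime p).mem_or_mem hm with hm | hm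
    · have hk' := (pointIdeal_isPrime p).mem_of_pow_mem _ hm
      refine hl (eq_coordPoint p l fun m hml => ?_)
      rcases hcover m with rfl | rfl | rfl | rfl
      exacts [hi, hj, hk', absurd rfl hml]
    · have hl' := (pointIdeal_isPrime p).mem_of_pow_mem _ hm
      refine hk (eq_coordPoint p k fun m hmk => ?_)
      rcases hcover m with rfl | rfl | rfl | rfl
      exacts [hi, hj, absurd rfl hmk, hl']

/-! ### Relations in the Chow group from quotients of coordinates. -/

open scoped Classical in
/-- A zero-cycle that is the divisor of `x_m / x_n` on a curve meeting both coordinate planes in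
coordinate points has trivial class. -/
theorem mk_eq_zero_of_coord {I C : Ideal S} (hC : IsCurve C) (hIC : I ≤ C)
    {m n i j k l i' j' k' l' : Fin 4} (hm : X m ∉ C) (hn : X n ∉ C)
    (h : [i, j, k, l].Nodup) (h' : [i', j', k', l'].Nodup) {a b a' b' : ℕ}
    (hG : C ⊔ Ideal.span {X m} = Ideal.span {X i, X j, X k ^ a * X l ^ b})
    (hN : C ⊔ Ideal.span {X n} = Ideal.span {X i', X j', X k' ^ a' * X l' ^ b'})
    (D : ZeroCycle I) (hD : ∀ p, D p =
      (a * (if p.1 = coordPoint l then 1 else 0) + b * (if p.1 = coordPoint k then 1 else 0)) -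
      (a' * (if p.1 = coordPoint l' then 1 else 0) +
        b' * (if p.1 = coordPoint k' then 1 else 0))) :
    (QuotientAddGroup.mk D : CH0 I) = 0 := by
  refine (QuotientAddGroup.eq_zero_iff D).2 (AddSubgroup.subset_closure
    ⟨C, hC, hIC, 1, X m, X n, isHomogeneous_X _ _, isHomogeneous_X _ _, hm, hn, fun p => ?_⟩)
  rw [ordAt, hG, hN, multAt_span h, multAt_span h', hD]

/-- The relation given by the divisor of `x_m / x_n` on a curve meeting both coordinate planes in
coordinate points. -/
theorem ofPoint_relation {I C : Ideal S} (hC : IsCurve C) (hIC : I ≤ C)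
    {m n i j k l i' j' k' l' : Fin 4} (hm : X m ∉ C) (hn : X n ∉ C)
    (h : [i, j, k, l].Nodup) (h' : [i', j', k', l'].Nodup) {a b a' b' : ℕ}
    (hG : C ⊔ Ideal.span {X m} = Ideal.span {X i, X j, X k ^ a * X l ^ b})
    (hN : C ⊔ Ideal.span {X n} = Ideal.span {X i', X j', X k' ^ a' * X l' ^ b'})
    (hk : MemV I (coordPoint k)) (hl : MemV I (coordPoint l))
    (hk' : MemV I (coordPoint k')) (hl' : MemV I (coordPoint l')) :
    a • CH0.ofPoint I _ hl + b • CH0.ofPoint I _ hk =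
      a' • CH0.ofPoint I _ hl' + b' • CH0.ofPoint I _ hk' := by
  rw [← sub_eq_zero]
  refine mk_eq_zero_of_coord hC hIC hm hn h h' hG hN
    (a • Finsupp.single ⟨_, hl⟩ 1 + b • Finsupp.single ⟨_, hk⟩ 1 -
      (a' • Finsupp.single ⟨_, hl'⟩ 1 + b' • Finsupp.single ⟨_, hk'⟩ 1)) fun p => ?_
  classical
  simp [Finsupp.single_apply, Subtype.ext_iff, @eq_comm _ p.1]

/-! ### Integrality and dimension of the curves. -/

theorem homogeneousComponent_mem_span {s : Set S} (hs : ∀ f ∈ s, ∃ n, f.IsHomogeneous n) {f : S}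
    (hf : f ∈ Ideal.span s) (d : ℕ) : homogeneousComponent d f ∈ Ideal.span s := by
  let _ : GradedRing (homogeneousSubmodule (Fin 4) ℂ) := gradedAlgebra
  have h := Ideal.homogeneous_span (homogeneousSubmodule (Fin 4) ℂ) s fun x hx => by
    obtain ⟨n, hn⟩ := hs x hx
    exact ⟨n, hn⟩
  have := h d hf
  rwa [show ((DirectSum.decompose (homogeneousSubmodule (Fin 4) ℂ) f d : _) : S) =
    homogeneousComponent d f from decomposition.decompose'_apply f d] at this

/-- A prime ideal generated by forms, of height at least two and contained in the ideals of two
distinct coordinate points, is the ideal of a curve. -/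
theorem isCurve_span {s : Set S} (hp : (Ideal.span s).IsPrime)
    (hs : ∀ f ∈ s, ∃ n, f.IsHomogeneous n) {i l m : Fin 4} {f : S} (hi : X i ∈ Ideal.span s)
    (hf : f ∈ Ideal.span s) (hfi : ¬ X i ∣ f) (hlm : l ≠ m) (hl : MemV (Ideal.span s) (coordPoint l))
    (hm : MemV (Ideal.span s) (coordPoint m)) : IsCurve (Ideal.span s) := by
  refine ⟨hp, fun f hf d => homogeneousComponent_mem_span hs hf d, le_antisymm ?_ ?_⟩
  -- Upper bound: dividing first by x_i and then by f, nonzero in the domain S/(x_i), lowers the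
  -- dimension 4 twice.
  · have hXp : (Ideal.span {(X i : S)}).IsPrime :=
      (Ideal.span_singleton_prime (X_ne_zero i)).2 X_prime
    have h1 : ringKrullDim (S ⧸ Ideal.span {(X i : S)}) + 1 ≤ ringKrullDim S :=
      ringKrullDim_quotient_succ_le_of_nonZeroDivisor
        (mem_nonZeroDivisors_of_ne_zero (X_ne_zero i))
    have hle : Ideal.span {(X i : S)} ≤ Ideal.span s := by
      rwa [Ideal.span_singleton_le_iff_mem]
    have h2 : ringKrullDim (S ⧸ Ideal.span s) + 1 ≤ ringKrullDim (S ⧸ Ideal.span {(X i : S)}) :=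
      ringKrullDim_succ_le_of_surjective (Ideal.Quotient.factor hle)
        (Ideal.Quotient.factor_surjective hle) (r := Ideal.Quotient.mk _ f)
        (mem_nonZeroDivisors_of_ne_zero fun h0 => hfi <| Ideal.mem_span_singleton.1 <|
          Ideal.Quotient.eq_zero_iff_mem.1 h0)
        (by simpa using Ideal.Quotient.eq_zero_iff_mem.2 hf)
    have h3 : ringKrullDim S = 4 := by simp
    rw [h3] at h1
    have h4 : ringKrullDim (S ⧸ Ideal.span s) + 1 + 1 ≤ 4 := by
      refine le_trans ?_ h1
      gcongr
    generalize ringKrullDim (S ⧸ Ideal.span s) = x at h4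
    induction x using WithBot.recBotCoe with
    | bot => simp
    | coe x =>
      induction x using ENat.recTopCoe with
      | top => exact absurd h4 (by decide)
      | coe n =>
        have h5 : ((n + 1 + 1 : ℕ) : ℕ∞) ≤ ((4 : ℕ) : ℕ∞) := WithBot.coe_le_coe.1 h4
        have h6 : n ≤ 2 := by
          have := Nat.cast_le.1 h5
          omega
        exact WithBot.coe_le_coe.2 (Nat.cast_le.2 h6 : (n : ℕ∞) ≤ ((2 : ℕ) : ℕ∞))
  -- Lower bound: the given prime, the ideal of the point l and the irrelevant ideal form a chain,
  -- strict because of x_m and then x_l.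
  · have h1 : ringKrullDim (S ⧸ pointIdeal (coordPoint l)) + 1 ≤
        ringKrullDim (S ⧸ Ideal.span s) :=
      ringKrullDim_succ_le_of_surjective (Ideal.Quotient.factor hl)
        (Ideal.Quotient.factor_surjective hl) (r := Ideal.Quotient.mk _ (X m))
        (mem_nonZeroDivisors_of_ne_zero fun h0 =>
          (X_mem_pointIdeal_coordPoint m m).1 (hm (Ideal.Quotient.eq_zero_iff_mem.1 h0)) rfl)
        (Ideal.Quotient.eq_zero_iff_mem.2 ((X_mem_pointIdeal_coordPoint l m).2 hlm.symm))
    have h2 : ringKrullDim ℂ + 1 ≤ ringKrullDim (S ⧸ pointIdeal (coordPoint l)) :=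
      ringKrullDim_succ_le_of_surjective
        (Ideal.Quotient.lift (pointIdeal (coordPoint l)) (MvPolynomial.constantCoeff : S →+* ℂ) fun f hf => by
          simpa [constantCoeff_eq] using (mem_pointIdeal_coordPoint l f).1 hf 0)
        (Ideal.Quotient.lift_surjective_of_surjective _ _ fun a => ⟨C a, by simp⟩)
        (r := Ideal.Quotient.mk _ (X l))
        (mem_nonZeroDivisors_of_ne_zero fun h0 =>
          (X_mem_pointIdeal_coordPoint l l).1 (Ideal.Quotient.eq_zero_iff_mem.1 h0) rfl)
        (by simp)
    rw [ringKrullDim_eq_zero_of_field] at h2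
    refine le_trans ?_ h1
    calc (2 : WithBot ℕ∞) = 0 + 1 + 1 := by norm_num
      _ ≤ _ := by gcongr

/-- Evaluation of the extra variable of `S[Z]` at a coordinate. -/
def substX (i : Fin 4) : Polynomial S →ₐ[ℂ] S :=
  (Polynomial.aeval (R := S) (X i : S)).restrictScalars ℂ

@[simp]
theorem substX_X (i : Fin 4) : substX i Polynomial.X = X i := by
  simp [substX]

@[simp]
theorem substX_C (i : Fin 4) (f : S) : substX i (Polynomial.C f) = f := by
  simp [substX]

theorem X_one_sq_not_dvd : ¬ (X 1 : S) ^ 2 ∣ X 1 * X 2 ^ 4 := by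
  rw [sq, mul_dvd_mul_iff_left (X_ne_zero 1)]
  intro h
  simpa using X_dvd_X.1 (X_prime.dvd_of_dvd_pow h)

/-- An Eisenstein polynomial with respect to the coordinate `x₁`. -/
theorem prime_eisenstein {n : ℕ} (hn : 2 ≤ n) (c d : S) (hc : ¬ X 1 ∣ c) (hd : X 1 ∣ d)
    (hprim : ∀ r : S, r ∣ c → r ∣ d → r ∣ X 1 * X 2 ^ 4 → IsUnit r) :
    Prime (Polynomial.C c * Polynomial.X ^ n + Polynomial.C d * Polynomial.X +
      Polynomial.C (X 1 * X 2 ^ 4 : S) : Polynomial S) := by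
  set g : Polynomial S := Polynomial.C c * Polynomial.X ^ n + Polynomial.C d * Polynomial.X +
    Polynomial.C (X 1 * X 2 ^ 4 : S) with hg
  have hc0 : c ≠ 0 := by
    rintro rfl
    exact hc (dvd_zero _)
  have hcoeff : ∀ m, g.coeff m = (if m = n then c else 0) + (if m = 1 then d else 0) +
      (if m = 0 then X 1 * X 2 ^ 4 else 0) := fun m => by
    rw [hg, Polynomial.coeff_add, Polynomial.coeff_add, Polynomial.coeff_C (n := m)]
    simp [Polynomial.coeff_X_pow, Polynomial.coeff_X, @eq_comm _ 1 m]
  have hdeg : g.degree = n := by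
    rw [hg, add_assoc, Polynomial.degree_add_eq_left_of_degree_lt,
      Polynomial.degree_C_mul_X_pow _ hc0]
    rw [Polynomial.degree_C_mul_X_pow _ hc0]
    refine lt_of_le_of_lt Polynomial.degree_linear_le ?_
    exact_mod_cast hn
  have hnat : g.natDegree = n := Polynomial.natDegree_eq_of_degree_eq_some hdeg
  -- The prime is (x₁), which divides the constant term x₁x₂⁴ exactly once; `hprim` is primitivity,
  -- and irreducible implies prime since S[Z] is factorial.
  refine (Polynomial.irreducible_of_eisenstein_criterion (P := Ideal.span {(X 1 : S)})
    ((Ideal.span_singleton_prime (X_ne_zero 1)).2 X_prime) ?_ ?_ ?_ ?_ ?_).prime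
  · rw [Polynomial.leadingCoeff, hnat, hcoeff, Ideal.mem_span_singleton]
    simpa [show n ≠ 1 by omega, show n ≠ 0 by omega] using hc
  · intro m hm
    rw [hdeg] at hm
    have hmn : m ≠ n := (Nat.cast_lt.1 hm).ne
    rw [hcoeff, Ideal.mem_span_singleton, if_neg hmn, zero_add]
    refine dvd_add ?_ ?_
    · split_ifs
      exacts [hd, dvd_zero _]
    · split_ifs
      exacts [dvd_mul_right _ _, dvd_zero _]
  · rw [hdeg]
    exact_mod_cast (by omega : 0 < n)
  · rw [hcoeff, Ideal.span_singleton_pow, Ideal.mem_span_singleton]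
    simpa [show 0 ≠ n by omega] using X_one_sq_not_dvd
  · intro r hr
    rw [Polynomial.C_dvd_iff_dvd_coeff] at hr
    refine hprim r ?_ ?_ ?_
    · simpa [hcoeff, show n ≠ 1 by omega, show n ≠ 0 by omega] using hr n
    · simpa [hcoeff, show 1 ≠ n by omega] using hr 1
    · simpa [hcoeff, show 0 ≠ n by omega] using hr 0

/-- Modulo x₃ the equation, read in Z = x₀, is x₂Z⁴ + x₁⁴Z + x₁x₂⁴. The target S[Z] keeps spare
variables, which is harmless for a retract. -/
theorem isPrime_Z₁ (t : ℂ) : (Z₁ t).IsPrime := by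
  have hg := prime_eisenstein (n := 4) (by norm_num) (X 2) (X 1 ^ 4) (by simp) (dvd_pow_self _ (by norm_num))
    (fun r h2 h1 _ => by
      rcases (X_prime (R := ℂ) (i := (2 : Fin 4))).irreducible.dvd_iff.1 h2 with h | h
      · exact h
      · exact absurd (X_dvd_X.1 (X_prime.dvd_of_dvd_pow (h.dvd.trans h1))) (by decide))
  have := (Ideal.span_singleton_prime hg.ne_zero).2 hg
  refine isPrime_of_retract (Z₁ t) (Ideal.span {_}) (hJ := this) (aeval ![Polynomial.X, Polynomial.C (X 1),
    Polynomial.C (X 2), 0]) (substX 0) ?_ ?_ ?_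
  · rw [Z₁, Ideal.span_le]
    rintro _ (rfl | rfl)
    · rw [SetLike.mem_coe, Ideal.mem_comap, Ideal.mem_span_singleton]
      refine dvd_of_eq ?_
      simp [F]
      ring
    · simp
  · rw [Ideal.span_singleton_le_iff_mem, Ideal.mem_comap]
    simp only [map_add, map_mul, map_pow, substX_X, substX_C]
    refine Ideal.mem_span_pair.2 ⟨1, -(X 3 ^ 4 + C t * X 1 ^ 4), ?_⟩
    simp only [F]
    ring
  · intro i
    fin_cases i <;> simp [Z₁]
    exact Ideal.subset_span (by simp)

/-- Modulo x₀ the equation, read in Z = x₃, is Z⁵ + t x₁⁴Z + x₁x₂⁴, which is monic. -/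
theorem isPrime_Z₂ (t : ℂ) : (Z₂ t).IsPrime := by
  have hg := prime_eisenstein (n := 5) (by norm_num) 1 (C t * X 1 ^ 4)
    (fun h => X_prime.not_isUnit (isUnit_of_dvd_one h))
    ((dvd_pow_self _ (by norm_num)).mul_left _) (fun r h1 _ _ => isUnit_of_dvd_one h1)
  have := (Ideal.span_singleton_prime hg.ne_zero).2 hg
  refine isPrime_of_retract (Z₂ t) (Ideal.span {_}) (hJ := this) (aeval ![0, Polynomial.C (X 1),
    Polynomial.C (X 2), Polynomial.X]) (substX 3) ?_ ?_ ?_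
  · rw [Z₂, Ideal.span_le]
    rintro _ (rfl | rfl)
    · rw [SetLike.mem_coe, Ideal.mem_comap, Ideal.mem_span_singleton]
      refine dvd_of_eq ?_
      simp [F]
      ring
    · simp
  · rw [Ideal.span_singleton_le_iff_mem, Ideal.mem_comap]
    simp only [map_add, map_mul, map_pow, substX_X, substX_C]
    refine Ideal.mem_span_pair.2 ⟨1, -(X 1 ^ 4 + X 2 * X 0 ^ 3), ?_⟩
    simp only [F]
    ring
  · intro i
    fin_cases i <;> simp [Z₂]
    exact Ideal.subset_span (by simp)

/-- The ideal of the line `x₀ = x₃ = 0`. -/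
def lineIdeal : Ideal S := Ideal.span {X 0, X 3}

theorem memV_span_iff (s : Set S) (l : Fin 4) :
    MemV (Ideal.span s) (coordPoint l) ↔ ∀ f ∈ s, ∀ c : ℂ, eval (Pi.single l c) f = 0 := by
  simp only [MemV, Ideal.span_le, Set.subset_def, SetLike.mem_coe, mem_pointIdeal_coordPoint]

theorem memV_lineIdeal {l : Fin 4} (h0 : l ≠ 0) (h3 : l ≠ 3) : MemV lineIdeal (coordPoint l) := by
  simp [lineIdeal, memV_span_iff, h0.symm, h3.symm]

theorem memV_Z₁ (t : OnePoint ℂ) {l : Fin 4} (h3 : l ≠ 3) : MemV (Z₁ t) (coordPoint l) := by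
  rw [Z₁, memV_span_iff]
  cases t with
  | infty => simp [F, h3.symm]
  | coe t => fin_cases l <;> simp_all [F]

theorem memV_Z₂ (t : OnePoint ℂ) {l : Fin 4} (h0 : l ≠ 0) (h3 : l ≠ 3) :
    MemV (Z₂ t) (coordPoint l) := by
  rw [Z₂, memV_span_iff]
  cases t with
  | infty => simp [F, h3.symm, h0.symm]
  | coe t => fin_cases l <;> simp_all [F]

theorem X_notMem_of_memV {I : Ideal S} {l : Fin 4} (h : MemV I (coordPoint l)) : X l ∉ I :=
  fun hl => (X_mem_pointIdeal_coordPoint l l).1 (h hl) rfl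

theorem isHomogeneous_F (t : OnePoint ℂ) : (F t).IsHomogeneous 5 := by
  have hX : ∀ (i j : Fin 4), (X i * X j ^ 4 : S).IsHomogeneous 5 := fun i j =>
    (isHomogeneous_X ℂ i).mul (isHomogeneous_X_pow j 4)
  cases t with
  | infty => exact hX 3 1
  | coe t =>
    refine ((((hX 0 1).add (hX 1 2)).add (hX 2 0)).add (isHomogeneous_X_pow 3 5)).add ?_
    rw [mul_assoc]
    simpa using (isHomogeneous_C (Fin 4) t).mul (hX 3 1)

theorem isCurve_lineIdeal : IsCurve lineIdeal := by
  have hp : (Ideal.span {(X 0 : S), X 3}).IsPrime := by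
    refine isPrime_of_retract _ (⊥ : Ideal S) (aeval ![0, X 1, X 2, 0]) (AlgHom.id ℂ S) ?_ bot_le ?_
    · rw [Ideal.span_le]
      rintro _ (rfl | rfl) <;> simp
    · intro i
      fin_cases i <;> simp
      all_goals exact Ideal.subset_span (by simp)
  refine isCurve_span hp ?_ (i := 0) (f := X 3) (Ideal.subset_span (by simp))
    (Ideal.subset_span (by simp)) (by simp) (l := 1) (m := 2) (by decide)
    (memV_lineIdeal (by decide) (by decide)) (memV_lineIdeal (by decide) (by decide))
  rintro _ (rfl | rfl) <;> exact ⟨1, isHomogeneous_X _ _⟩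

theorem isCurve_Z₁ (t : ℂ) : IsCurve (Z₁ t) := by
  refine isCurve_span (isPrime_Z₁ t) ?_ (i := 3) (f := F t) (Ideal.subset_span (by simp))
    (Ideal.subset_span (by simp)) ?_ (l := 1) (m := 2) (by decide)
    (memV_Z₁ t (by decide)) (memV_Z₁ t (by decide))
  · rintro _ (rfl | rfl)
    exacts [⟨5, isHomogeneous_F _⟩, ⟨1, isHomogeneous_X _ _⟩]
  · rintro ⟨g, hg⟩
    -- A point of the plane x₃ = 0 at which F takes the value 1.
    have := congrArg (eval ![1, 1, 0, 0]) hg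
    simp [F] at this

theorem isCurve_Z₂ (t : ℂ) : IsCurve (Z₂ t) := by
  refine isCurve_span (isPrime_Z₂ t) ?_ (i := 0) (f := F t) (Ideal.subset_span (by simp))
    (Ideal.subset_span (by simp)) ?_ (l := 1) (m := 2) (by decide)
    (memV_Z₂ t (by decide) (by decide)) (memV_Z₂ t (by decide) (by decide))
  · rintro _ (rfl | rfl)
    exacts [⟨5, isHomogeneous_F _⟩, ⟨1, isHomogeneous_X _ _⟩]
  · rintro ⟨g, hg⟩
    have := congrArg (eval ![0, 1, 1, 0]) hg
    simp [F] at this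

/-! ### Divisors of the coordinates and the torsion relations. -/

/-- Two ideals generated by a form and two variables agree if the forms agree modulo the
variables. -/
theorem span_pair_sup_eq (f g x y a b : S) (h : f = g + a * x + b * y) :
    Ideal.span {f, x} ⊔ Ideal.span {y} = Ideal.span {x, y, g} := by
  subst h
  have hx : x ∈ Ideal.span {x, y, g} := Ideal.subset_span (by simp)
  have hy : y ∈ Ideal.span {x, y, g} := Ideal.subset_span (by simp)
  have hg : g ∈ Ideal.span {x, y, g} := Ideal.subset_span (by simp)
  apply le_antisymm
  · rw [sup_le_iff, Ideal.span_le, Ideal.span_le]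
    refine ⟨?_, by simpa using hy⟩
    rintro _ (rfl | rfl)
    · exact Ideal.add_mem _ (Ideal.add_mem _ hg (Ideal.mul_mem_left _ _ hx))
        (Ideal.mul_mem_left _ _ hy)
    · exact hx
  · have hx' : x ∈ Ideal.span {g + a * x + b * y, x} ⊔ Ideal.span {y} :=
      Ideal.mem_sup_left (Ideal.subset_span (by simp))
    have hy' : y ∈ Ideal.span {g + a * x + b * y, x} ⊔ Ideal.span {y} :=
      Ideal.mem_sup_right (Ideal.subset_span (by simp))
    have hf' : g + a * x + b * y ∈ Ideal.span {g + a * x + b * y, x} ⊔ Ideal.span {y} :=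
      Ideal.mem_sup_left (Ideal.subset_span (by simp))
    rw [Ideal.span_le]
    rintro _ (rfl | rfl | rfl)
    · exact hx'
    · exact hy'
    · simpa using Ideal.sub_mem _ (Ideal.sub_mem _ hf' (Ideal.mul_mem_left _ b hy'))
        (Ideal.mul_mem_left _ a hx')

theorem Z₁_sup_X_zero (t : ℂ) :
    Z₁ t ⊔ Ideal.span {X 0} = Ideal.span {X 3, X 0, X 2 ^ 4 * X 1 ^ 1} :=
  span_pair_sup_eq _ _ _ _ (X 3 ^ 4 + C t * X 1 ^ 4) (X 1 ^ 4 + X 2 * X 0 ^ 3) (by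
    simp only [F]; ring)

theorem Z₁_sup_X_one (t : ℂ) :
    Z₁ t ⊔ Ideal.span {X 1} = Ideal.span {X 3, X 1, X 0 ^ 4 * X 2 ^ 1} :=
  span_pair_sup_eq _ _ _ _ (X 3 ^ 4 + C t * X 1 ^ 4) (X 0 * X 1 ^ 3 + X 2 ^ 4) (by
    simp only [F]; ring)

theorem Z₁_sup_X_two (t : ℂ) :
    Z₁ t ⊔ Ideal.span {X 2} = Ideal.span {X 3, X 2, X 1 ^ 4 * X 0 ^ 1} :=
  span_pair_sup_eq _ _ _ _ (X 3 ^ 4 + C t * X 1 ^ 4) (X 1 * X 2 ^ 3 + X 0 ^ 4) (by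
    simp only [F]; ring)

theorem Z₂_sup_X_three (t : ℂ) :
    Z₂ t ⊔ Ideal.span {X 3} = Ideal.span {X 0, X 3, X 2 ^ 4 * X 1 ^ 1} :=
  span_pair_sup_eq _ _ _ _ (X 1 ^ 4 + X 2 * X 0 ^ 3) (X 3 ^ 4 + C t * X 1 ^ 4) (by
    simp only [F]; ring)

theorem Z₂_sup_X_one (t : ℂ) :
    Z₂ t ⊔ Ideal.span {X 1} = Ideal.span {X 0, X 1, X 3 ^ 5 * X 2 ^ 0} :=
  span_pair_sup_eq _ _ _ _ (X 1 ^ 4 + X 2 * X 0 ^ 3) (X 2 ^ 4 + C t * X 3 * X 1 ^ 3) (by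
    simp only [F]; ring)

/-- Otherwise the prime ideal would contain x₁x₂⁴, hence x₁ or x₂, although P and Q lie on the
curve. -/
theorem X_three_notMem_Z₂ (t : ℂ) : X 3 ∉ Z₂ t := by
  intro h3
  have h : (X 1 * X 2 ^ 4 : S) ∈ Z₂ t := by
    have : (X 2 ^ 4 * X 1 ^ 1 : S) ∈ Z₂ t ⊔ Ideal.span {X 3} := by
      rw [Z₂_sup_X_three]
      exact Ideal.subset_span (by simp)
    rw [sup_eq_left.2 ((Ideal.span_singleton_le_iff_mem _).2 h3)] at this
    simpa [mul_comm] using this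
  rcases (isPrime_Z₂ t).mem_or_mem h with h | h
  · exact X_notMem_of_memV (memV_Z₂ t (l := 1) (by decide) (by decide)) h
  · exact X_notMem_of_memV (memV_Z₂ t (l := 2) (by decide) (by decide))
      ((isPrime_Z₂ t).mem_of_pow_mem _ h)

/-- The two points are rationally equivalent as soon as `V(I)` contains the line `x₀ = x₃ = 0`. -/
theorem ofPoint_eq_of_le_lineIdeal {I : Ideal S} (hI : I ≤ lineIdeal)
    (h1 : MemV I (coordPoint 1)) (h2 : MemV I (coordPoint 2)) :
    CH0.ofPoint I _ h1 = CH0.ofPoint I _ h2 := by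
  have hP : MemV lineIdeal (coordPoint 1) := memV_lineIdeal (by decide) (by decide)
  have hQ : MemV lineIdeal (coordPoint 2) := memV_lineIdeal (by decide) (by decide)
  have h := ofPoint_relation isCurve_lineIdeal hI (m := 2) (n := 1)
    (i := 0) (j := 3) (k := 2) (l := 1) (i' := 0) (j' := 3) (k' := 1) (l' := 2)
    (a := 1) (b := 0) (a' := 1) (b' := 0) (X_notMem_of_memV hQ) (X_notMem_of_memV hP)
    (by decide) (by decide)
    (by rw [lineIdeal, ← Ideal.span_union]; congr 1; ext; simp; tauto)
    (by rw [lineIdeal, ← Ideal.span_union]; congr 1; ext; simp; tauto) h2 h1 h1 h2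
  simpa using h

theorem four_smul_ofPoint_Z₂ (t : OnePoint ℂ) (h1 : MemV (Z₂ t) (coordPoint 1))
    (h2 : MemV (Z₂ t) (coordPoint 2)) :
    4 • CH0.ofPoint (Z₂ t) _ h1 = 4 • CH0.ofPoint (Z₂ t) _ h2 := by
  cases t with
  | infty =>
    rw [ofPoint_eq_of_le_lineIdeal _ h1 h2]
    rw [Z₂, Ideal.span_le]
    rintro _ (rfl | rfl)
    · exact Ideal.mul_mem_right _ _ (Ideal.subset_span (by simp))
    · exact Ideal.subset_span (by simp)
  | coe t =>
    rw [← sub_eq_zero]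
    -- `ofPoint_relation` is not available: it would need E, the zero of x₂ on the line x₀ = x₁ = 0,
    -- to lie on the curve. Here E only enters with coefficient 0.
    refine mk_eq_zero_of_coord (isCurve_Z₂ t) le_rfl (X_three_notMem_Z₂ t) (X_notMem_of_memV h1)
      (by decide) (by decide) (Z₂_sup_X_three t) (Z₂_sup_X_one t)
      (4 • Finsupp.single ⟨_, h1⟩ 1 - 4 • Finsupp.single ⟨_, h2⟩ 1) fun p => ?_
    classical
    simp [Finsupp.single_apply, Subtype.ext_iff, @eq_comm _ p.1]
    split_ifs <;> norm_num

theorem thirteen_smul_ofPoint_Z₁ (t : OnePoint ℂ) (h1 : MemV (Z₁ t) (coordPoint 1))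
    (h2 : MemV (Z₁ t) (coordPoint 2)) :
    13 • CH0.ofPoint (Z₁ t) _ h1 = 13 • CH0.ofPoint (Z₁ t) _ h2 := by
  cases t with
  | infty =>
    rw [ofPoint_eq_of_le_lineIdeal _ h1 h2]
    rw [Z₁, Ideal.span_le]
    rintro _ (rfl | rfl)
    · exact Ideal.mul_mem_right _ _ (Ideal.subset_span (by simp))
    · exact Ideal.subset_span (by simp)
  | coe t =>
    have h0 : MemV (Z₁ t) (coordPoint 0) := memV_Z₁ t (by decide)
    have e1 := ofPoint_relation (isCurve_Z₁ t) le_rfl (X_notMem_of_memV h0)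
      (X_notMem_of_memV h1) (by decide) (by decide) (Z₁_sup_X_zero t) (Z₁_sup_X_one t) h2 h1 h0 h2
    have e2 := ofPoint_relation (isCurve_Z₁ t) le_rfl (X_notMem_of_memV h2)
      (X_notMem_of_memV h0) (by decide) (by decide) (Z₁_sup_X_two t) (Z₁_sup_X_zero t) h1 h0 h2 h1
    generalize CH0.ofPoint (Z₁ t) _ h0 = a at *
    generalize CH0.ofPoint (Z₁ t) _ h1 = p at *
    generalize CH0.ofPoint (Z₁ t) _ h2 = q at *
    have e3 : a = 4 • p - 3 • q := by
      rw [one_smul, one_smul] at e1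
      have : a = (4 • p + q) - 4 • q := by rw [e1]; abel
      rw [this]
      module
    subst e3
    rw [← sub_eq_zero] at e2 ⊢
    rw [← e2]
    module

/-! ### Smoothness of the affine charts. -/

theorem sum_single_mul_pderiv (m : Fin 4) (b g : S) :
    ∑ n, (Pi.single m b : Fin 4 → S) n * pderiv n g = b * pderiv m g := by
  simp [Pi.single_apply]

/-- The Jacobian criterion for an affine chart of a plane curve. -/
theorem smooth_chart {f : S} {i j k l : Fin 4} (h : [i, j, k, l].Nodup) (β γ a b : S) (N : ℕ)
    (hv : β * pderiv k f + γ * pderiv l f = X i ^ N + a * f + b * X j) :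
    Algebra.Smooth ℂ (ChartRing (Ideal.span {f, X j}) i) := by
  have hf : f ∈ Ideal.span {f, X j} ⊔ Ideal.span {X i - 1} :=
    Ideal.mem_sup_left (Ideal.subset_span (by simp))
  have hj : X j ∈ Ideal.span {f, X j} ⊔ Ideal.span {X i - 1} :=
    Ideal.mem_sup_left (Ideal.subset_span (by simp))
  have hi : X i - 1 ∈ Ideal.span {f, X j} ⊔ Ideal.span {X i - 1} :=
    Ideal.mem_sup_right (Ideal.subset_span (by simp))
  have hv1 : β * pderiv k f + γ * pderiv l f - 1 ∈
      Ideal.span {f, X j} ⊔ Ideal.span {X i - 1} := by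
    rw [hv, show X i ^ N + a * f + b * X j - 1 = (X i ^ N - 1) + a * f + b * X j by ring]
    exact Ideal.add_mem _ (Ideal.add_mem _
      (Ideal.mem_of_dvd _ (sub_one_dvd_pow_sub_one (X i) N) hi)
      (Ideal.mul_mem_left _ _ hf)) (Ideal.mul_mem_left _ _ hj)
  clear hv
  have hz : ∀ m, pderiv m f - pderiv m f * (β * pderiv k f + γ * pderiv l f) ∈
      Ideal.span {f, X j} ⊔ Ideal.span {X i - 1} := fun m => by
    have := Ideal.mul_mem_left _ (-pderiv m f) hv1
    convert this using 1
    ring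
  simp only [List.nodup_cons, List.mem_cons, List.not_mem_nil, or_false, not_or,
    not_false_eq_true, List.nodup_nil, and_true] at h
  obtain ⟨⟨hij, hik, hil⟩, ⟨hjk, hjl⟩, -⟩ := h
  -- The derivation w has value 1 on f modulo the ideal and kills x_i and x_j. Subtracting multiples
  -- of w from ∂_j and ∂_i makes them kill f, which completes a right inverse of the Jacobian
  -- matrix.
  let w : Fin 4 → S := Pi.single k β + Pi.single l γ
  have hw : ∀ g, ∑ n, w n * pderiv n g = β * pderiv k g + γ * pderiv l g := fun g => by
    simp only [w, Pi.add_apply, add_mul, Finset.sum_add_distrib, sum_single_mul_pderiv]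
  have hw' : ∀ m g, ∑ n, ((Pi.single m 1 : Fin 4 → S) n - pderiv m f * w n) * pderiv n g =
      pderiv m g - pderiv m f * (β * pderiv k g + γ * pderiv l g) := fun m g => by
    simp only [sub_mul, Finset.sum_sub_distrib, sum_single_mul_pderiv, mul_assoc,
      ← Finset.mul_sum, hw, one_mul]
  let v : Fin 3 → Fin 4 → S :=
    ![w, fun n => (Pi.single j 1 : Fin 4 → S) n - pderiv j f * w n,
      fun n => (Pi.single i 1 : Fin 4 → S) n - pderiv i f * w n]
  have hD : ∀ r g, ∑ n, v r n * pderiv n g = ![β * pderiv k g + γ * pderiv l g,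
      pderiv j g - pderiv j f * (β * pderiv k g + γ * pderiv l g),
      pderiv i g - pderiv i f * (β * pderiv k g + γ * pderiv l g)] r := by
    intro r g
    fin_cases r
    exacts [hw g, hw' j g, hw' i g]
  refine smooth_of_jacobian ![f, X j, X i - 1] _ ?_ v ?_
  · rw [← Ideal.span_union]
    congr 1
    ext
    simp
    tauto
  · intro r c
    rw [hD]
    fin_cases r <;> fin_cases c <;>
      simp [hv1, hz, pderiv_X, hij, hik, hil, hjk, hjl, Ne.symm hij]

theorem smooth_quotient_of_eq_top {I : Ideal S} (hI : I = ⊤) : Algebra.Smooth ℂ (S ⧸ I) :=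
  smooth_of_jacobian (fun _ : Unit => (1 : S)) I (by simp [hI]) 0 (by simp [hI])

theorem chart_eq_top {I : Ideal S} {i : Fin 4} (h : X i ∈ I) : I ⊔ Ideal.span {X i - 1} = ⊤ := by
  rw [Ideal.eq_top_iff_one]
  simpa using Ideal.sub_mem _ (Ideal.mem_sup_left h : X i ∈ I ⊔ Ideal.span {X i - 1})
    (Ideal.mem_sup_right (Ideal.mem_span_singleton_self _))

theorem isSmoothV_Z₁_infty : IsSmoothV (Z₁ OnePoint.infty) := by
  have hI : Z₁ OnePoint.infty = Ideal.span {X 3} := by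
    refine le_antisymm (Ideal.span_le.2 ?_) (Ideal.span_mono (by simp))
    rintro _ (rfl | rfl)
    · exact Ideal.mul_mem_right _ _ (Ideal.mem_span_singleton_self _)
    · exact Ideal.mem_span_singleton_self _
  intro i
  rw [hI]
  by_cases hi : i = 3
  · subst hi
    exact smooth_quotient_of_eq_top (chart_eq_top (Ideal.mem_span_singleton_self _))
  · refine smooth_of_jacobian ![X 3, X i - 1] _ ?_
      ![Pi.single 3 1, Pi.single i 1] ?_
    · rw [← Ideal.span_union]
      congr 1
      ext
      simp
    · intro a b
      fin_cases a <;> fin_cases b <;>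
        simp [pderiv_X, Pi.single_apply, hi, Ne.symm hi]

theorem pderiv_zero_F (t : ℂ) : pderiv 0 (F t) = X 1 ^ 4 + 4 * X 2 * X 0 ^ 3 := by
  simp [F, pderiv_X]
  ring

theorem pderiv_one_F (t : ℂ) :
    pderiv 1 (F t) = 4 * X 0 * X 1 ^ 3 + X 2 ^ 4 + 4 * C t * X 3 * X 1 ^ 3 := by
  simp [F, pderiv_X]
  ring

theorem pderiv_two_F (t : ℂ) : pderiv 2 (F t) = 4 * X 1 * X 2 ^ 3 + X 0 ^ 4 := by
  simp [F, pderiv_X]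
  ring

theorem pderiv_three_F (t : ℂ) : pderiv 3 (F t) = 5 * X 3 ^ 4 + C t * X 1 ^ 4 := by
  simp [F, pderiv_X, mul_comm]

theorem F_coe (t : ℂ) : F t =
    X 0 * X 1 ^ 4 + X 1 * X 2 ^ 4 + X 2 * X 0 ^ 4 + X 3 ^ 5 + C t * X 3 * X 1 ^ 4 := rfl

theorem isSmoothV_Z₁ (t : OnePoint ℂ) : IsSmoothV (Z₁ t) := by
  cases t with
  | infty => exact isSmoothV_Z₁_infty
  | coe t =>
    obtain ⟨c, hc⟩ : ∃ c : S, 13 * c = 1 :=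
      ⟨C (1 / 13), by rw [← map_ofNat C 13, ← map_mul]; norm_num⟩
    intro i
    fin_cases i
    -- With u = x₁x₂³ and x₃ = 0, the combination of partials minus 64c x₁x₂²f is x₀⁸ + (4 -
    -- 52c)ux₀⁴, so c = 1/13 leaves x₀⁸. The other two charts are cyclic permutations; all terms in
    -- x₃ go into the last coefficient.
    · refine smooth_chart (i := 0) (k := 1) (l := 2) (by decide) (16 * c * X 1 ^ 2 * X 2 ^ 2)
        (X 0 ^ 4 + 12 * c * X 1 * X 2 ^ 3) (64 * c * X 1 * X 2 ^ 2)
        (64 * c * X 1 ^ 2 * X 2 ^ 2 * C t * X 1 ^ 3 -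
          64 * c * X 1 * X 2 ^ 2 * (X 3 ^ 4 + C t * X 1 ^ 4)) 8 ?_
      rw [pderiv_one_F, pderiv_two_F, F_coe]
      linear_combination -4 * X 1 * X 2 ^ 3 * X 0 ^ 4 * hc
    · refine smooth_chart (i := 1) (k := 2) (l := 0) (by decide) (16 * c * X 2 ^ 2 * X 0 ^ 2)
        (X 1 ^ 4 + 12 * c * X 2 * X 0 ^ 3) (64 * c * X 2 * X 0 ^ 2)
        (-64 * c * X 2 * X 0 ^ 2 * (X 3 ^ 4 + C t * X 1 ^ 4)) 8 ?_
      rw [pderiv_two_F, pderiv_zero_F, F_coe]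
      linear_combination -4 * X 2 * X 0 ^ 3 * X 1 ^ 4 * hc
    · refine smooth_chart (i := 2) (k := 0) (l := 1) (by decide) (16 * c * X 0 ^ 2 * X 1 ^ 2)
        (X 2 ^ 4 + 12 * c * X 0 * X 1 ^ 3) (64 * c * X 0 * X 1 ^ 2)
        ((X 2 ^ 4 + 12 * c * X 0 * X 1 ^ 3) * 4 * C t * X 1 ^ 3 -
          64 * c * X 0 * X 1 ^ 2 * (X 3 ^ 4 + C t * X 1 ^ 4)) 8 ?_
      rw [pderiv_zero_F, pderiv_one_F, F_coe]
      linear_combination -4 * X 0 * X 1 ^ 3 * X 2 ^ 4 * hc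
    · exact smooth_quotient_of_eq_top (chart_eq_top (Ideal.subset_span (by simp)))

theorem isSmoothV_Z₂ {t : ℂ} (ht : t ≠ 0) : IsSmoothV (Z₂ t) := by
  obtain ⟨d, hd⟩ : ∃ d : S, 16 * d = 1 :=
    ⟨C (1 / 16), by rw [← map_ofNat C 16, ← map_mul]; norm_num⟩
  obtain ⟨s, hs⟩ : ∃ s : S, s * C t = 1 :=
    ⟨C t⁻¹, by rw [← map_mul, inv_mul_cancel₀ ht, map_one]⟩
  intro i
  fin_cases i
  · exact smooth_quotient_of_eq_top (chart_eq_top (Ideal.subset_span (by simp)))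
  -- Only this chart, the one containing P, needs the inverse s of t.
  · refine smooth_chart (i := 1) (k := 2) (l := 3) (by decide) (25 * d * s ^ 2 * X 3 ^ 3 * X 2)
      (s * X 1 ^ 4 + 20 * d * s ^ 2 * X 3 ^ 4) (100 * d * s ^ 2 * X 3 ^ 3)
      (25 * d * s ^ 2 * X 3 ^ 3 * X 2 * X 0 ^ 3 -
        100 * d * s ^ 2 * X 3 ^ 3 * (X 1 ^ 4 + X 2 * X 0 ^ 3)) 8 ?_
    rw [pderiv_two_F, pderiv_three_F, F_coe]
    linear_combination (X 1 ^ 8 - 5 * s * X 1 ^ 4 * X 3 ^ 4) * hs -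
      5 * s * (s * C t) * X 1 ^ 4 * X 3 ^ 4 * hd
  · refine smooth_chart (i := 2) (k := 1) (l := 3) (by decide) (X 2 ^ 4 + C t * X 3 * X 1 ^ 3)
      (C t * X 3 ^ 2 * X 1 ^ 2) (5 * C t * X 3 * X 1 ^ 2)
      ((X 2 ^ 4 + C t * X 3 * X 1 ^ 3) * 4 * X 1 ^ 3 -
        5 * C t * X 3 * X 1 ^ 2 * (X 1 ^ 4 + X 2 * X 0 ^ 3)) 8 ?_
    rw [pderiv_one_F, pderiv_three_F, F_coe]
    ring
  -- A weighted Euler relation: modulo x₀, -(4x₁∂₁F + 3x₂∂₂F)/16 equals x₃⁵ - F.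
  · refine smooth_chart (i := 3) (k := 1) (l := 2) (by decide) (-4 * d * X 1) (-3 * d * X 2) (-1)
      (-16 * d * X 1 ^ 4 - 3 * d * X 2 * X 0 ^ 3 + (X 1 ^ 4 + X 2 * X 0 ^ 3)) 5 ?_
    rw [pderiv_one_F, pderiv_two_F, F_coe]
    linear_combination -(X 1 * X 2 ^ 4 + C t * X 3 * X 1 ^ 4) * hd

/-! ### The special curve at t = 0: rationality and multiplicity at P. -/

/-- Where x₂ = 1 the equation becomes x₁ = -x₃⁵, so this chart is an affine line with coordinate x₃.
-/
theorem isRationalCurve_Z₂_zero : IsRationalCurve (Z₂ ((0 : ℂ) : OnePoint ℂ)) := by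
  refine ⟨isCurve_Z₂ 0, 2, X_notMem_of_memV (memV_Z₂ _ (by decide) (by decide)), ?_⟩
  let φ : S →ₐ[ℂ] Polynomial ℂ := aeval ![0, -Polynomial.X ^ 5, 1, Polynomial.X]
  let ψ : Polynomial ℂ →ₐ[ℂ] S := Polynomial.aeval (X 3)
  set I : Ideal S := Z₂ ((0 : ℂ) : OnePoint ℂ) ⊔ Ideal.span {X 2 - 1} with hI
  have hφ : I ≤ RingHom.ker φ := by
    rw [hI, Z₂, sup_le_iff, Ideal.span_le, Ideal.span_le]
    constructor
    · rintro _ (rfl | rfl)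
      · rw [SetLike.mem_coe, RingHom.mem_ker, F_coe]
        simp [φ]
      · simp [φ]
    · rintro _ rfl
      simp [φ]
  have h0 : X 0 ∈ I := Ideal.mem_sup_left (Ideal.subset_span (by simp))
  have h2 : X 2 - 1 ∈ I := Ideal.mem_sup_right (Ideal.subset_span (by simp))
  have hF : F ((0 : ℂ) : OnePoint ℂ) ∈ I := Ideal.mem_sup_left (Ideal.subset_span (by simp))
  have h1 : X 1 + X 3 ^ 5 ∈ I := by
    have h4 : X 2 ^ 4 - 1 ∈ I := Ideal.mem_of_dvd _ (sub_one_dvd_pow_sub_one (X 2) 4) h2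
    have := I.sub_mem (I.sub_mem hF (I.mul_mem_left (X 1 ^ 4 + X 2 * X 0 ^ 3) h0))
      (I.mul_mem_left (X 1) h4)
    rw [F_coe, map_zero] at this
    convert this using 1
    ring
  have e : ChartRing (Z₂ ((0 : ℂ) : OnePoint ℂ)) 2 ≃ₐ[ℂ] Polynomial ℂ := by
    refine quotientEquivOfRetract I φ ψ hφ (Polynomial.algHom_ext (by simp [φ, ψ])) fun i => ?_
    fin_cases i
    · simpa [φ, ψ] using h0
    · simpa [φ, ψ] using h1
    · simpa [φ, ψ] using h2
    · simp [φ, ψ]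
  exact ⟨IsFractionRing.algEquivOfAlgEquiv e⟩

/-- Modulo x₀ the form is x₁x₂⁴ + x₃⁵, visibly in the fourth power of the maximal ideal. Its image
under `localExpand 1 2` is a nonzero constant times the fourth power of the series variable, while
the fifth power of the maximal ideal and x₀ land in multiples of the fifth power. -/
theorem hasMultiplicity_four :
    HasMultiplicity (Ideal.span {X 0}) (F ((0 : ℂ) : OnePoint ℂ)) P 4 := by
  rw [P_eq_coordPoint]
  have hF : F ((0 : ℂ) : OnePoint ℂ) =
      X 1 * X 2 ^ 4 + X 3 * X 3 ^ 4 + (X 1 ^ 4 + X 2 * X 0 ^ 3) * X 0 := by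
    rw [F_coe, map_zero]
    ring
  have hm : ∀ i ≠ 1, algebraMap S (ConeLocalRing (coordPoint 1)) (X i) ∈
      IsLocalRing.maximalIdeal (ConeLocalRing (coordPoint 1)) := fun i hi => by
    rw [← Localization.AtPrime.map_eq_maximalIdeal]
    exact Ideal.mem_map_of_mem _ ((X_mem_pointIdeal_coordPoint 1 i).2 hi)
  constructor
  · rw [hF]
    simp only [map_add, map_mul, map_pow]
    refine Ideal.add_mem _ (Ideal.mem_sup_left (Ideal.add_mem _ ?_ ?_)) (Ideal.mem_sup_right ?_)
    · exact Ideal.mul_mem_left _ _ (Ideal.pow_mem_pow (hm 2 (by decide)) 4)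
    · exact Ideal.mul_mem_left _ _ (Ideal.pow_mem_pow (hm 3 (by decide)) 4)
    · exact Ideal.mul_mem_left _ _ (Ideal.mem_map_of_mem _ (Ideal.mem_span_singleton_self _))
  · intro h
    have hle : IsLocalRing.maximalIdeal (ConeLocalRing (coordPoint 1)) ^ (4 + 1) ⊔
        (Ideal.span {X 0}).map (algebraMap S _) ≤
        (Ideal.span {(PowerSeries.X : PowerSeries (RatFunc ℂ)) ^ 5}).comap
          (localExpand 1 2) := by
      rw [sup_le_iff]
      constructor
      · rw [← Ideal.span_singleton_pow]
        refine le_trans (Ideal.pow_right_mono ?_ 5) (Ideal.le_comap_pow _ 5)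
        rw [← Localization.AtPrime.map_eq_maximalIdeal, Ideal.map_le_iff_le_comap]
        refine pointIdeal_coordPoint_le 1 _ fun i hi => ?_
        rw [Ideal.mem_comap, Ideal.mem_comap, localExpand_algebraMap, Ideal.mem_span_singleton]
        simp only [expand, aeval_X, if_neg hi]
        split_ifs
        exacts [dvd_rfl, dvd_zero _]
      · rw [Ideal.map_le_iff_le_comap, Ideal.span_singleton_le_iff_mem, Ideal.mem_comap,
          Ideal.mem_comap, localExpand_algebraMap]
        simp [expand]
    have h1 := hle h
    rw [Ideal.mem_comap, localExpand_algebraMap, hF, Ideal.mem_span_singleton,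
      PowerSeries.X_pow_dvd_iff] at h1
    have h2 := h1 4 (by norm_num)
    simp [expand, PowerSeries.coeff_X_pow] at h2
    exact RatFunc.X_ne_zero h2

end ShiodaQuintic

end

theorem proposition6p5 :
    (∀ t : OnePoint ℂ, ShiodaQuintic.IsSmoothV (ShiodaQuintic.Z₁ t)) ∧
    (∀ t : OnePoint ℂ, t ≠ ((0 : ℂ) : OnePoint ℂ) → t ≠ OnePoint.infty →
      ShiodaQuintic.IsSmoothV (ShiodaQuintic.Z₂ t)) ∧
    ShiodaQuintic.IsRationalCurve (ShiodaQuintic.Z₂ ((0 : ℂ) : OnePoint ℂ)) ∧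
    ShiodaQuintic.HasMultiplicity (Ideal.span {MvPolynomial.X 0})
      (ShiodaQuintic.F ((0 : ℂ) : OnePoint ℂ)) ShiodaQuintic.P 4 ∧
    (∀ t : OnePoint ℂ,
      ∃ (hP₁ : ShiodaQuintic.MemV (ShiodaQuintic.Z₁ t) ShiodaQuintic.P)
        (hQ₁ : ShiodaQuintic.MemV (ShiodaQuintic.Z₁ t) ShiodaQuintic.Q)
        (hP₂ : ShiodaQuintic.MemV (ShiodaQuintic.Z₂ t) ShiodaQuintic.P)
        (hQ₂ : ShiodaQuintic.MemV (ShiodaQuintic.Z₂ t) ShiodaQuintic.Q),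
        4 • ShiodaQuintic.CH0.ofPoint (ShiodaQuintic.Z₂ t) ShiodaQuintic.P hP₂ =
          4 • ShiodaQuintic.CH0.ofPoint (ShiodaQuintic.Z₂ t) ShiodaQuintic.Q hQ₂ ∧
        13 • ShiodaQuintic.CH0.ofPoint (ShiodaQuintic.Z₁ t) ShiodaQuintic.P hP₁ =
          13 • ShiodaQuintic.CH0.ofPoint (ShiodaQuintic.Z₁ t) ShiodaQuintic.Q hQ₁) := by
  refine ⟨ShiodaQuintic.isSmoothV_Z₁, fun t h0 hinf => ?_, ShiodaQuintic.isRationalCurve_Z₂_zero,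
    ShiodaQuintic.hasMultiplicity_four, fun t => ?_⟩
  · cases t with
    | infty => exact absurd rfl hinf
    | coe t => exact ShiodaQuintic.isSmoothV_Z₂ fun h => h0 (congrArg _ h)
  · rw [ShiodaQuintic.P_eq_coordPoint, ShiodaQuintic.Q_eq_coordPoint]
    exact ⟨ShiodaQuintic.memV_Z₁ t (by decide), ShiodaQuintic.memV_Z₁ t (by decide),
      ShiodaQuintic.memV_Z₂ t (by decide) (by decide),
      ShiodaQuintic.memV_Z₂ t (by decide) (by decide),
      ShiodaQuintic.four_smul_ofPoint_Z₂ t _ _, ShiodaQuintic.thirteen_smul_ofPoint_Z₁ t _ _⟩
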